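/- Let $\phi:\mathcal X\to\mathbb R^d$ be a fixed feature map; a sample is a pair $(x,y)\in\mathcal X\times\mathbb R^c$ with feature vector $f=\phi(x)$. There are $K$ clients. Client $k$ holds a multiset $\mathcal D_{k,t}$ of samples, with $\mathcal D_{k,0}=\emptyset$; in round $t\ge 1$ it deletes a batch $\mathcal D^-_{k,t}\subseteq\mathcal D_{k,t-1}$ and adds a batch $\mathcal D^+_{k,t}$ (both multisets). Let $\mathcal D_t=\biguplus_k\mathcal D_{k,t}$, and let $F_t\in\mathbb R^{n\times d}$, $Y_t\in\mathbb R^{n\times c}$ be the matrices whose rows are the features $f_i$ and the labels $y_i$ of the samples of $\mathcal D_t$, listed in any order. In round $t$ client $k$, with feature and label matrices $F^\pm_{k,t},Y^\pm_{k,t}$ of its two batches, sends only $S^\pm_{k,t}=(F^\pm_{k,t})^\top F^\pm_{k,t}$ and $G^\pm_{k,t}=(F^\pm_{k,t})^\top Y^\pm_{k,t}$ to the server, which keeps $$S_0=0,\quad G_0=0,\quad S_t=S_{t-1}+\sum_k S^+_{k,t}-\sum_k S^-_{k,t},\quad G_t=G_{t-1}+\sum_k G^+_{k,t}-\sum_k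 G^-_{k,t}.$$ Let $\sigma,\tau>0$ and $\gamma=\sigma^2/\tau^2$, and set $W_t=(S_t+\gamma I)^{-1}G_t$. Consider the Bayesian model in which $W\in\mathbb R^{d\times c}$ has the prior $\mathrm{vec}(W)\sim\mathcal N(0,\tau^2I_{dc})$ and, given $W$ and the features, the labels are independent with $y_i\mid f_i,W\sim\mathcal N(W^\top f_i,\sigma^2I_c)$. Let $\mathcal{MN}(M,U,V)$ denote the matrix normal law, that is, the law of $W$ with $\mathrm{vec}(W)\sim\mathcal N(\mathrm{vec}(M),V\otimes U)$. Let $\Pi_t^{\mathrm{retrain}}$ be the posterior of $W$ given $\mathcal D_t$, computed from scratch by Bayes' formula (prior times the Gaussian likelihood of all labels of $\mathcal D_t$, normalized; as a function of the labels this is a version of the conditional law of $W$ given the labels). Then for every $t\ge 0$ the following hold. The server maintains the exact statistics of the retained data, $S_t=F_t^\top F_t$ and $G_t=F_t^\top Y_t$, and $S_t+\gamma I$ is positive definite. The law $$\Pi_t=\mathcal{MN}\bigl(W_t,\ \sigma^2(S_t+\gamma I)^{-1},\ I_c\bigr)$$ that the protocol maintains is the exact posterior given the retained data: $\Pi_t=\Pi_t^{\mathrm{retrain}}$.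 Consequently $\mathrm{KL}(\Pi_t\,\|\,\Pi_t^{\mathrm{retrain}})=0$. -/

import Mathlib

open MeasureTheory ProbabilityTheory Matrix
open scoped ENNReal Kronecker

namespace FedUnlearn

/-! ### The measurable space of real matrices, and the matrix normal law -/

/-- Real matrices carry the product (entrywise) σ-algebra. -/
instance instMeasurableSpaceRealMatrix {m n : Type*} : MeasurableSpace (Matrix m n ℝ) :=
  inferInstanceAs (MeasurableSpace (m → n → ℝ))

instance instStandardBorelSpaceRealMatrix {m n : Type*} [Finite m] [Finite n] :
    StandardBorelSpace (Matrix m n ℝ) :=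
  inferInstanceAs (StandardBorelSpace (m → n → ℝ))

/-- The matrix whose column-stacking vectorization is `v`; the inverse of `Matrix.vec`. -/
def unvec {m n : Type*} (v : EuclideanSpace ℝ (n × m)) : Matrix m n ℝ :=
  Matrix.of fun i j => v (j, i)

/-- `unvec` inverts the vectorization. -/
theorem unvec_vec {m n : Type*} (A : Matrix m n ℝ) : unvec (WithLp.toLp 2 A.vec) = A := rfl

theorem measurable_unvec {m n : Type*} [Fintype m] [Fintype n] :
    Measurable (unvec : EuclideanSpace ℝ (n × m) → Matrix m n ℝ) := by
  refine measurable_pi_lambda _ fun i => measurable_pi_lambda _ fun j => ?_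
  change Measurable fun v : EuclideanSpace ℝ (n × m) => v (j, i)
  fun_prop

/-- The matrix normal law `MN(M, U, V)` with mean `M`, row covariance `U` and column
covariance `V`: the law of the random matrix `W` with `vec W ∼ N(vec M, V ⊗ U)`. -/
noncomputable def matrixNormal {m n : Type*} [Fintype m] [DecidableEq m] [Fintype n]
    [DecidableEq n] (M : Matrix m n ℝ) (U : Matrix m m ℝ) (V : Matrix n n ℝ) :
    Measure (Matrix m n ℝ) :=
  (multivariateGaussian (WithLp.toLp 2 M.vec) (V ⊗ₖ U)).map unvec

/-! ### The Bayesian linear model -/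

section Model

variable {d c n : ℕ}

/-- The prior: the law of the random `d × c` matrix `W` with `vec W ∼ N(0, τ² I_{dc})`. -/
noncomputable def prior (d c : ℕ) (τ : ℝ) : Measure (Matrix (Fin d) (Fin c) ℝ) :=
  (multivariateGaussian (0 : EuclideanSpace ℝ (Fin c × Fin d)) (τ ^ 2 • 1)).map unvec

instance isProbabilityMeasure_prior (τ : ℝ) : IsProbabilityMeasure (prior d c τ) :=
  Measure.isProbabilityMeasure_map measurable_unvec.aemeasurable

/-- The mean `Wᵀ f` of a label with feature vector `f`, under the parameter `W`. -/
noncomputable def labelMean (W : Matrix (Fin d) (Fin c) ℝ) (f : EuclideanSpace ℝ (Fin d)) :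
    EuclideanSpace ℝ (Fin c) :=
  WithLp.toLp 2 (Wᵀ *ᵥ f)

theorem measurable_labelMean (f : EuclideanSpace ℝ (Fin d)) :
    Measurable fun W : Matrix (Fin d) (Fin c) ℝ => labelMean W f := by
  refine (WithLp.measurable_toLp 2 (Fin c → ℝ)).comp (measurable_pi_lambda _ fun j => ?_)
  change Measurable fun W : Matrix (Fin d) (Fin c) ℝ => ∑ i, W i j * f i
  refine Finset.measurable_sum _ fun i _ =>
    Measurable.mul_const (M := ℝ) (f := fun W : Matrix (Fin d) (Fin c) ℝ => W i j) ?_ (f i)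
  exact (measurable_pi_apply j).comp (measurable_pi_apply i)

/-- Joint law of the labels `y₁, …, yₙ` under the parameter `W`, for given features: the `y_i`
are independent with `y_i ∼ N(Wᵀ f_i, σ² I_c)`. -/
noncomputable def labelLaw (σ : ℝ) (f : Fin n → EuclideanSpace ℝ (Fin d))
    (W : Matrix (Fin d) (Fin c) ℝ) : Measure (Fin n → EuclideanSpace ℝ (Fin c)) :=
  Measure.pi fun i => multivariateGaussian (labelMean W (f i)) (σ ^ 2 • 1)

open scoped MatrixOrder in
theorem measurable_labelLaw (σ : ℝ) (f : Fin n → EuclideanSpace ℝ (Fin d)) :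
    Measurable (labelLaw (c := c) σ f) := by
  have h : ∀ W : Matrix (Fin d) (Fin c) ℝ, labelLaw σ f W =
      (Measure.pi fun _ : Fin n => stdGaussian (EuclideanSpace ℝ (Fin c))).map
        (fun x i => labelMean W (f i) +
          toEuclideanCLM (𝕜 := ℝ) (CFC.sqrt ((σ ^ 2) • (1 : Matrix (Fin c) (Fin c) ℝ))) (x i)) := by
    intro W
    rw [Measure.pi_map_pi (f := fun i y => labelMean W (f i) +
          toEuclideanCLM (𝕜 := ℝ) (CFC.sqrt ((σ ^ 2) • (1 : Matrix (Fin c) (Fin c) ℝ))) y)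
        (hμ := fun i =>
          inferInstanceAs (SigmaFinite (multivariateGaussian (labelMean W (f i))
            ((σ ^ 2) • (1 : Matrix (Fin c) (Fin c) ℝ)))))
        (fun i => by fun_prop)]
    rfl
  have hm : Measurable fun p : Matrix (Fin d) (Fin c) ℝ × (Fin n → EuclideanSpace ℝ (Fin c)) =>
      fun i : Fin n => labelMean p.1 (f i) +
        toEuclideanCLM (𝕜 := ℝ)
          (CFC.sqrt ((σ ^ 2) • (1 : Matrix (Fin c) (Fin c) ℝ))) (p.2 i) := by
    refine measurable_pi_lambda _ fun i => Measurable.add ?_ ?_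
    · exact (measurable_labelMean (f i)).comp measurable_fst
    · fun_prop
  refine Measure.measurable_of_measurable_coe _ fun s hs => ?_
  simp_rw [h]
  have : ∀ W : Matrix (Fin d) (Fin c) ℝ, _ = _ := fun W =>
    Measure.map_apply (μ := Measure.pi fun _ : Fin n => stdGaussian (EuclideanSpace ℝ (Fin c)))
      (hm.comp (measurable_prodMk_left (x := W))) hs
  simp only [Function.comp_def] at this
  simp_rw [this]
  exact measurable_measure_prodMk_left (hm hs)

/-- The likelihood as a Markov kernel from parameters to label tuples, for given features. -/
noncomputable def labelKernel (c : ℕ) (σ : ℝ) (f : Fin n → EuclideanSpace ℝ (Fin d)) :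
    Kernel (Matrix (Fin d) (Fin c) ℝ) (Fin n → EuclideanSpace ℝ (Fin c)) where
  toFun := labelLaw σ f
  measurable' := measurable_labelLaw σ f

instance isMarkovKernel_labelKernel (σ : ℝ) (f : Fin n → EuclideanSpace ℝ (Fin d)) :
    IsMarkovKernel (labelKernel c σ f) :=
  ⟨fun W => by change IsProbabilityMeasure (labelLaw σ f W); unfold labelLaw; infer_instance⟩

/-- The likelihood function of the parameter `W` at the observed data `(f_i, y_i)`: the product of
the densities of `N(Wᵀ f_i, σ² I_c)` at `y_i`, for `σ > 0`. -/
noncomputable def likelihood (σ : ℝ) (f : Fin n → EuclideanSpace ℝ (Fin d))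
    (y : Fin n → EuclideanSpace ℝ (Fin c)) (W : Matrix (Fin d) (Fin c) ℝ) : ℝ≥0∞ :=
  ∏ i, ENNReal.ofReal ((Real.sqrt (2 * Real.pi * σ ^ 2) ^ c)⁻¹ *
    Real.exp (-‖y i - labelMean W (f i)‖ ^ 2 / (2 * σ ^ 2)))

/-- The Bayesian posterior of `W` given the observed data `(f_i, y_i)`, by Bayes' formula: the
density with respect to the prior is the likelihood divided by its prior mean (the evidence). -/
noncomputable def bayesPosterior (σ τ : ℝ) (f : Fin n → EuclideanSpace ℝ (Fin d))
    (y : Fin n → EuclideanSpace ℝ (Fin c)) : Measure (Matrix (Fin d) (Fin c) ℝ) :=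
  (∫⁻ W, likelihood σ f y W ∂(prior d c τ))⁻¹ •
    (prior d c τ).withDensity (likelihood σ f y)

end Model

/-! ### Federated data streams and the protocol -/

section Protocol

variable {X : Type*} {d c n K : ℕ}

/-- A sample: a raw input together with its label in `ℝᶜ`. -/
abbrev Sample (X : Type*) (c : ℕ) : Type _ := X × EuclideanSpace ℝ (Fin c)

/-- The feature matrix `F` of a tuple of samples: row `i` is `φ(x_i)`. -/
def featureMatrix (φ : X → EuclideanSpace ℝ (Fin d)) (z : Fin n → Sample X c) :
    Matrix (Fin n) (Fin d) ℝ :=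
  Matrix.of fun i j => φ (z i).1 j

/-- The label matrix `Y` of a tuple of samples: row `i` is `y_i`. -/
def labelMatrix (z : Fin n → Sample X c) : Matrix (Fin n) (Fin c) ℝ :=
  Matrix.of fun i j => (z i).2 j

open Classical in
/-- The multiset retained by one client: empty at time `0`; in round `t + 1` the batch
`del (t + 1)` is removed and the batch `add (t + 1)` is added. -/
noncomputable def retained {α : Type*} (add del : ℕ → Multiset α) : ℕ → Multiset α
  | 0 => 0
  | t + 1 => retained add del t - del (t + 1) + add (t + 1)

/-- What a client sends to the server in one round: the sufficient statistics `(S⁺, G⁺)` of its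
added batch and `(S⁻, G⁻)` of its deleted batch. -/
structure ClientMessage (d c : ℕ) where
  addGram : Matrix (Fin d) (Fin d) ℝ
  addMoment : Matrix (Fin d) (Fin c) ℝ
  delGram : Matrix (Fin d) (Fin d) ℝ
  delMoment : Matrix (Fin d) (Fin c) ℝ

/-- The samples of a batch, listed in some order. -/
noncomputable def enumerate {α : Type*} (B : Multiset α) : Fin B.toList.length → α :=
  B.toList.get

/-- The client forms the feature and label matrices of both batches, and from them the
statistics `S± = (F±)ᵀ F±`, `G± = (F±)ᵀ Y±`. -/
noncomputable def clientMessage (φ : X → EuclideanSpace ℝ (Fin d))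
    (Badd Bdel : Multiset (Sample X c)) : ClientMessage d c where
  addGram := (featureMatrix φ (enumerate Badd))ᵀ * featureMatrix φ (enumerate Badd)
  addMoment := (featureMatrix φ (enumerate Badd))ᵀ * labelMatrix (enumerate Badd)
  delGram := (featureMatrix φ (enumerate Bdel))ᵀ * featureMatrix φ (enumerate Bdel)
  delMoment := (featureMatrix φ (enumerate Bdel))ᵀ * labelMatrix (enumerate Bdel)

/-- The server's retained-statistics ledger `(S, G)`. -/
structure Ledger (d c : ℕ) where
  gram : Matrix (Fin d) (Fin d) ℝ
  moment : Matrix (Fin d) (Fin c) ℝ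

/-- The server's ledger after round `t`, computed from the client messages only:
`S_0 = 0`, `G_0 = 0`, `S_{t+1} = S_t + ∑_k S⁺_k - ∑_k S⁻_k`, and likewise for `G`. -/
noncomputable def ledger (msg : ℕ → Fin K → ClientMessage d c) : ℕ → Ledger d c
  | 0 => ⟨0, 0⟩
  | t + 1 =>
    ⟨(ledger msg t).gram + ∑ k, (msg (t + 1) k).addGram - ∑ k, (msg (t + 1) k).delGram,
      (ledger msg t).moment + ∑ k, (msg (t + 1) k).addMoment - ∑ k, (msg (t + 1) k).delMoment⟩

/-- The ridge head `(S + γ I)⁻¹ G` that the server recovers from its ledger. -/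
noncomputable def head (γ : ℝ) (L : Ledger d c) : Matrix (Fin d) (Fin c) ℝ :=
  (L.gram + γ • 1)⁻¹ * L.moment

/-- The distribution `MN(W, σ² (S + γ I)⁻¹, I_c)`, with `W` the ridge head, that the server
maintains through its ledger. -/
noncomputable def protocolPosterior (σ γ : ℝ) (L : Ledger d c) :
    Measure (Matrix (Fin d) (Fin c) ℝ) :=
  matrixNormal (head γ L) (σ ^ 2 • (L.gram + γ • 1)⁻¹) 1

end Protocol

end FedUnlearn

namespace FedUnlearn

/-! ### The ledger holds the sufficient statistics of the retained data -/

section Statistics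

variable {X : Type*} {d c n K : ℕ}

/-! Two independent facts combine. First, `Fᵀ F` and `Fᵀ Y` are sums over samples of `φ(x) φ(x)ᵀ`
and `φ(x) yᵀ`. They are therefore additive functions of the multiset of samples, blind to its
ordering and to its split among clients, and since each deleted batch is contained in the retained
data, subtracting its statistics undoes its contribution exactly (`ledger_eq`).

Second, the Gaussian model is conjugate. The exponent of prior times likelihood is quadratic in `W`,
and completing the square (`completing_the_square`) turns it into the exponent of the matrix normal
law with mean `(S + γI)⁻¹ G`, plus a term free of `W`. Normalizing constants are never compared:
once prior times likelihood is a positive finite multiple of a probability measure, dividing by its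
total mass returns that measure (`inv_lintegral_smul_withDensity_eq`).

The densities come from `multivariateGaussian_isotropic`, by characteristic functions, and for a
general covariance from an affine change of variables. Bayes' formula is a version of the
conditional law because all label laws have densities for one reference measure
(`posterior_ae_eq_of_withDensity`). The divergence vanishes because its two arguments are the same
measure. -/

theorem sum_map_ofFn {α M : Type*} [AddCommMonoid M] (g : α → M) (z : Fin n → α) :
    ((Multiset.ofList (List.ofFn z)).map g).sum = ∑ i, g (z i) := by
  simp [List.map_ofFn, List.sum_ofFn]

theorem ofFn_enumerate {α : Type*} (B : Multiset α) :
    Multiset.ofList (List.ofFn (enumerate B)) = B := by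
  rw [enumerate, List.ofFn_get, Multiset.coe_toList]

/-- The contribution of one sample to the Gram matrix. -/
def sampleGram (φ : X → EuclideanSpace ℝ (Fin d)) (s : Sample X c) : Matrix (Fin d) (Fin d) ℝ :=
  Matrix.of fun i j => φ s.1 i * φ s.1 j

/-- The contribution of one sample to the moment matrix. -/
def sampleMoment (φ : X → EuclideanSpace ℝ (Fin d)) (s : Sample X c) :
    Matrix (Fin d) (Fin c) ℝ :=
  Matrix.of fun i j => φ s.1 i * s.2 j

/-- The right side sees only the underlying multiset, so the order of the rows becomes irrelevant.
-/
theorem featureMatrix_gram (φ : X → EuclideanSpace ℝ (Fin d)) (z : Fin n → Sample X c) :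
    (featureMatrix φ z)ᵀ * featureMatrix φ z =
      ((Multiset.ofList (List.ofFn z)).map (sampleGram φ)).sum := by
  rw [sum_map_ofFn]
  ext i j
  simp [Matrix.mul_apply, Matrix.sum_apply, featureMatrix, sampleGram]

theorem featureMatrix_moment (φ : X → EuclideanSpace ℝ (Fin d)) (z : Fin n → Sample X c) :
    (featureMatrix φ z)ᵀ * labelMatrix z =
      ((Multiset.ofList (List.ofFn z)).map (sampleMoment φ)).sum := by
  rw [sum_map_ofFn]
  ext i j
  simp [Matrix.mul_apply, Matrix.sum_apply, featureMatrix, labelMatrix, sampleMoment]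

/-- Multiset subtraction is truncated. The inclusion `h` rules truncation out, so adding the deleted
batch back recovers the old multiset, and the deletion becomes a true subtraction in the group `M`.
-/
theorem sum_map_retained_succ {α M : Type*} [AddCommGroup M] (g : α → M)
    (add del : ℕ → Multiset α) (t : ℕ) (h : del (t + 1) ≤ retained add del t) :
    ((retained add del (t + 1)).map g).sum =
      ((retained add del t).map g).sum + ((add (t + 1)).map g).sum -
        ((del (t + 1)).map g).sum := by
  classical
  have key : retained add del t - del (t + 1) + del (t + 1) = retained add del t :=
    tsub_add_cancel_of_le h
  have hsum := congrArg (fun B => (B.map g).sum) key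
  simp only [Multiset.map_add, Multiset.sum_add] at hsum
  have hdef : retained add del (t + 1) = retained add del t - del (t + 1) + add (t + 1) := by
    rw [retained]
  rw [hdef, Multiset.map_add, Multiset.sum_add, ← hsum]
  abel

theorem ledger_eq_sum (φ : X → EuclideanSpace ℝ (Fin d))
    (add del : Fin K → ℕ → Multiset (Sample X c))
    (hdel : ∀ k t, del k (t + 1) ≤ retained (add k) (del k) t) (t : ℕ) :
    ledger (fun t k => clientMessage φ (add k t) (del k t)) t =
      ⟨∑ k, ((retained (add k) (del k) t).map (sampleGram φ)).sum,
        ∑ k, ((retained (add k) (del k) t).map (sampleMoment φ)).sum⟩ := by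
  induction t with
  | zero => simp [ledger, retained]
  | succ t ih =>
    rw [ledger, ih]
    simp only [clientMessage, featureMatrix_gram, featureMatrix_moment,
      ofFn_enumerate, sum_map_retained_succ _ _ _ _ (hdel _ t), Finset.sum_sub_distrib,
      Finset.sum_add_distrib]

theorem ledger_eq (φ : X → EuclideanSpace ℝ (Fin d))
    (add del : Fin K → ℕ → Multiset (Sample X c))
    (hdel : ∀ k t, del k (t + 1) ≤ retained (add k) (del k) t) (t : ℕ)
    (z : Fin n → Sample X c)
    (hz : Multiset.ofList (List.ofFn z) = ∑ k, retained (add k) (del k) t) :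
    ledger (fun t k => clientMessage φ (add k t) (del k t)) t =
      ⟨(featureMatrix φ z)ᵀ * featureMatrix φ z, (featureMatrix φ z)ᵀ * labelMatrix z⟩ := by
  have hsum : ∀ {M : Type} [AddCommMonoid M] (g : Sample X c → M),
      ((∑ k, retained (add k) (del k) t).map g).sum =
        ∑ k, ((retained (add k) (del k) t).map g).sum := fun g => by
    rw [← Multiset.coe_mapAddMonoidHom, ← Multiset.coe_sumAddMonoidHom, map_sum, map_sum]
  rw [ledger_eq_sum φ add del hdel, featureMatrix_gram, featureMatrix_moment, hz, hsum, hsum]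

end Statistics

end FedUnlearn

namespace FedUnlearn

/-! ### Measures with densities -/

theorem map_withDensity_comp {α β : Type*} [MeasurableSpace α] [MeasurableSpace β]
    (μ : Measure α) {T : α → β} (hT : Measurable T) {g : β → ℝ≥0∞} (hg : Measurable g) :
    (μ.withDensity (g ∘ T)).map T = (μ.map T).withDensity g := by
  ext s hs
  rw [Measure.map_apply hT hs, withDensity_apply _ (hT hs), withDensity_apply _ hs,
    setLIntegral_map hs hg hT]
  rfl

/-- Induction on `n`: split off coordinate `0` and apply Tonelli. -/
theorem lintegral_pi_prod_eq {n : ℕ} {α : Type*} [MeasurableSpace α] (μ : Measure α)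
    [SigmaFinite μ] (g : Fin n → α → ℝ≥0∞) (hg : ∀ i, Measurable (g i)) :
    ∫⁻ x : Fin n → α, ∏ i, g i (x i) ∂Measure.pi (fun _ => μ) = ∏ i, ∫⁻ x, g i x ∂μ := by
  induction n with
  | zero => simp
  | succ n ih =>
    have hmp := (measurePreserving_piFinSuccAbove (fun _ : Fin (n + 1) => μ) 0).symm
    have hm : Measurable fun x : Fin (n + 1) → α => ∏ i, g i (x i) :=
      Finset.measurable_prod _ fun i _ => (hg i).comp (measurable_pi_apply i)
    rw [← hmp.lintegral_comp hm]
    simp only [Fin.prod_univ_succ, MeasurableEquiv.piFinSuccAbove_symm_apply,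
      Fin.insertNthEquiv_zero, Fin.consEquiv_apply, Fin.cons_zero, Fin.cons_succ]
    rw [← ih (fun i => g i.succ) fun i => hg i.succ]
    exact lintegral_prod_mul (μ := μ) (ν := Measure.pi fun _ : Fin n => μ) (f := g 0)
      (g := fun x : Fin n → α => ∏ i, g i.succ (x i)) (hg 0).aemeasurable
      (Finset.measurable_prod _ fun i _ =>
        (hg i.succ).comp (measurable_pi_apply i)).aemeasurable

/-- A product measure is determined by its values on boxes, and the indicator of a box is the
product of the indicators of its sides. -/
theorem pi_withDensity {n : ℕ} {α : Type*} [MeasurableSpace α] (μ : Measure α)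
    [SigmaFinite μ] (g : Fin n → α → ℝ≥0∞) (hg : ∀ i, Measurable (g i))
    [∀ i, SigmaFinite (μ.withDensity (g i))] :
    Measure.pi (fun i => μ.withDensity (g i)) =
      (Measure.pi fun _ => μ).withDensity fun x => ∏ i, g i (x i) := by
  refine Measure.pi_eq fun s hs => ?_
  rw [withDensity_apply _ (MeasurableSet.univ_pi hs),
    ← lintegral_indicator (MeasurableSet.univ_pi hs)]
  have h : ∀ x : Fin n → α, (Set.univ.pi s).indicator (fun x => ∏ i, g i (x i)) x =
      ∏ i, (s i).indicator (g i) (x i) := by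
    intro x
    by_cases hx : x ∈ Set.univ.pi s
    · rw [Set.indicator_of_mem hx]
      exact Finset.prod_congr rfl fun i _ => (Set.indicator_of_mem (hx i trivial) _).symm
    · rw [Set.indicator_of_notMem hx]
      simp only [Set.mem_univ_pi, not_forall] at hx
      obtain ⟨i, hi⟩ := hx
      exact (Finset.prod_eq_zero (Finset.mem_univ i) (Set.indicator_of_notMem hi _)).symm
  simp_rw [h]
  rw [lintegral_pi_prod_eq μ _ fun i => (hg i).indicator (hs i)]
  exact Finset.prod_congr rfl fun i _ => by
    rw [lintegral_indicator (hs i), withDensity_apply _ (hs i)]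

/-- Evaluating `h` on the whole space shows that the evidence is `k`, because `ν` has mass one.
Hence a posterior need only be found up to a factor. -/
theorem inv_lintegral_smul_withDensity_eq {α : Type*} [MeasurableSpace α] {μ ν : Measure α}
    [IsProbabilityMeasure ν] {l : α → ℝ≥0∞} {k : ℝ≥0∞} (hk : k ≠ 0) (hk' : k ≠ ∞)
    (h : μ.withDensity l = k • ν) :
    (∫⁻ x, l x ∂μ)⁻¹ • μ.withDensity l = ν := by
  have hl : ∫⁻ x, l x ∂μ = k := by
    rw [← setLIntegral_univ, ← withDensity_apply _ MeasurableSet.univ, h]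
    simp
  rw [hl, h, smul_smul, ENNReal.inv_mul_cancel hk hk', one_smul]

/-- Conjugacy in abstract form: `g` is the prior density, `l` the likelihood and `p` the
unnormalized target density, compared before transport along `T`. It is applied with `T = unvec`, so
no reference measure on matrices is needed. -/
theorem map_withDensity_eq_smul_map {α β : Type*} [MeasurableSpace α] [MeasurableSpace β]
    {ρ μ ν : Measure α} {T : α → β} (hT : Measurable T) {g p : α → ℝ≥0∞} (hg : Measurable g)
    {l : β → ℝ≥0∞} (hl : Measurable l) {C k : ℝ≥0∞} (hC : C ≠ ∞) (hk : k ≠ 0) (hk' : k ≠ ∞)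
    (hμ : μ = ρ.withDensity g) (hν : ν = k • ρ.withDensity p)
    (h : ∀ x, g x * l (T x) = C * p x) :
    (μ.map T).withDensity l = (C * k⁻¹) • ν.map T := by
  have h' : g * (l ∘ T) = C • p := funext h
  rw [← map_withDensity_comp _ hT hl, hμ, ← withDensity_mul _ hg (hl.comp hT), h',
    withDensity_smul' _ _ hC, hν, Measure.map_smul, Measure.map_smul, smul_smul, mul_assoc,
    ENNReal.inv_mul_cancel hk hk', mul_one]

/-! ### Densities of Gaussian laws -/

section Gaussian

open scoped MatrixOrder

variable {ι : Type*} [Fintype ι]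

/-- The density of the isotropic Gaussian law `N(m, σ² I)`. -/
noncomputable def isotropicDensity (σ : ℝ) (m x : EuclideanSpace ℝ ι) : ℝ :=
  (Real.sqrt (2 * Real.pi * σ ^ 2) ^ Fintype.card ι)⁻¹ *
    Real.exp (-‖x - m‖ ^ 2 / (2 * σ ^ 2))

theorem isotropicDensity_pos {σ : ℝ} (hσ : 0 < σ) (m x : EuclideanSpace ℝ ι) :
    0 < isotropicDensity σ m x := by
  unfold isotropicDensity
  positivity

theorem integrable_isotropicDensity {σ : ℝ} (hσ : 0 < σ) (m : EuclideanSpace ℝ ι) :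
    Integrable (isotropicDensity σ m) := by
  have h : Integrable (fun v : EuclideanSpace ℝ ι => Real.exp (-(2 * σ ^ 2)⁻¹ * ‖v‖ ^ 2)) := by
    -- The complex Gaussian with zero linear term; its norm is the real one.
    have := (GaussianFourier.integrable_cexp_neg_mul_sq_norm_add (V := EuclideanSpace ℝ ι)
      (b := ((2 * σ ^ 2)⁻¹ : ℝ)) (by rw [Complex.ofReal_re]; positivity) 0 0).norm
    refine this.congr (Filter.Eventually.of_forall fun v => ?_)
    simp only [Complex.norm_exp]
    congr 1
    simp [← Complex.ofReal_pow, ← Complex.ofReal_mul]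
  refine ((h.comp_sub_right m).const_mul
    (Real.sqrt (2 * Real.pi * σ ^ 2) ^ Fintype.card ι)⁻¹).congr
    (Filter.Eventually.of_forall fun x => ?_)
  simp only [isotropicDensity]
  congr 2
  ring

theorem integral_isotropicDensity_smul_cexp {σ : ℝ} (hσ : 0 < σ) (m t : EuclideanSpace ℝ ι) :
    ∫ x, isotropicDensity σ m x • Complex.exp (inner ℝ x t * Complex.I) =
      Complex.exp (inner ℝ t m * Complex.I - σ ^ 2 * ‖t‖ ^ 2 / 2) := by
  have hσ0 : (σ : ℂ) ≠ 0 := by exact_mod_cast hσ.ne'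
  have hb : 0 < (((2 * σ ^ 2)⁻¹ : ℝ) : ℂ).re := by rw [Complex.ofReal_re]; positivity
  -- With `b = 1 / (2σ²)` the Gaussian integral is the complex power `(π / b) ^ (card ι / 2)`, which
  -- has to cancel the normalizing constant of the density.
  have hC : ((Real.pi : ℂ) / (((2 * σ ^ 2)⁻¹ : ℝ) : ℂ)) ^ (Fintype.card ι / 2 : ℂ) =
      ((Real.sqrt (2 * Real.pi * σ ^ 2) ^ Fintype.card ι : ℝ) : ℂ) := by
    have hpos : (0 : ℝ) ≤ 2 * Real.pi * σ ^ 2 := by positivity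
    have h1 : (Real.pi : ℂ) / (((2 * σ ^ 2)⁻¹ : ℝ) : ℂ) = ((2 * Real.pi * σ ^ 2 : ℝ) : ℂ) := by
      push_cast
      field_simp
    have h2 : (Fintype.card ι / 2 : ℂ) = ((1 / 2 * Fintype.card ι : ℝ) : ℂ) := by
      push_cast
      ring
    rw [h1, h2, ← Complex.ofReal_cpow hpos, Real.rpow_mul hpos, ← Real.sqrt_eq_rpow,
      Real.rpow_natCast]
  have hC0 : ((Real.sqrt (2 * Real.pi * σ ^ 2) ^ Fintype.card ι : ℝ) : ℂ) ≠ 0 := by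
    have : (0 : ℝ) < Real.sqrt (2 * Real.pi * σ ^ 2) ^ Fintype.card ι := by positivity
    exact_mod_cast this.ne'
  have hint : ∀ v : EuclideanSpace ℝ ι,
      isotropicDensity σ m (v + m) • Complex.exp (inner ℝ (v + m) t * Complex.I) =
        (((Real.sqrt (2 * Real.pi * σ ^ 2) ^ Fintype.card ι : ℝ) : ℂ)⁻¹ *
          Complex.exp (inner ℝ t m * Complex.I)) *
        Complex.exp (-(((2 * σ ^ 2)⁻¹ : ℝ) : ℂ) * ‖v‖ ^ 2 + Complex.I * inner ℝ t v) := by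
    intro v
    rw [isotropicDensity, add_sub_cancel_right, Complex.real_smul, Complex.ofReal_mul,
      Complex.ofReal_inv, Complex.ofReal_exp, mul_assoc _ (Complex.exp _),
      mul_assoc _ (Complex.exp _), ← Complex.exp_add, ← Complex.exp_add, inner_add_left, real_inner_comm t v, real_inner_comm t m]
    congr 2
    push_cast
    field_simp
    ring
  -- Translation by `m` centres the Gaussian and leaves the phase `exp (i⟨t, m⟩)` as a constant
  -- factor.
  rw [← integral_add_right_eq_self _ m]
  simp_rw [hint]
  rw [integral_const_mul, GaussianFourier.integral_cexp_neg_mul_sq_norm_add_of_euclideanSpace hb,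
    hC, ← mul_assoc, mul_right_comm (_⁻¹ : ℂ), inv_mul_cancel₀ hC0, one_mul, ← Complex.exp_add]
  congr 1
  rw [Complex.I_sq]
  push_cast
  field_simp
  ring

/-- Both sides are finite measures with the same characteristic function. -/
theorem multivariateGaussian_isotropic [DecidableEq ι] {σ : ℝ} (hσ : 0 < σ) (m : EuclideanSpace ℝ ι) :
    multivariateGaussian m (σ ^ 2 • (1 : Matrix ι ι ℝ)) =
      volume.withDensity fun x => ENNReal.ofReal (isotropicDensity σ m x) := by
  have hfin : IsFiniteMeasure
      ((volume : Measure (EuclideanSpace ℝ ι)).withDensity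
        fun x => ENNReal.ofReal (isotropicDensity σ m x)) :=
    isFiniteMeasure_withDensity_ofReal (integrable_isotropicDensity hσ m).2
  apply Measure.ext_of_charFun
  ext t
  have hS : (σ ^ 2 • (1 : Matrix ι ι ℝ)).PosSemidef :=
    PosSemidef.one.smul (sq_nonneg σ)
  have hmeas : Measurable fun x : EuclideanSpace ℝ ι => (isotropicDensity σ m x).toNNReal := by
    unfold isotropicDensity
    fun_prop
  rw [charFun_multivariateGaussian hS, charFun_apply]
  have hd : (fun x : EuclideanSpace ℝ ι => ENNReal.ofReal (isotropicDensity σ m x)) =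
      fun x => ((isotropicDensity σ m x).toNNReal : ℝ≥0∞) := rfl
  rw [hd, integral_withDensity_eq_integral_smul hmeas]
  have hcoe : ∀ x, ∀ w : ℂ, (isotropicDensity σ m x).toNNReal • w = isotropicDensity σ m x • w :=
    fun x w => by
      rw [NNReal.smul_def, Real.coe_toNNReal _ (isotropicDensity_pos hσ m x).le]
  simp_rw [hcoe, integral_isotropicDensity_smul_cexp hσ]
  congr 2
  rw [Matrix.smul_mulVec, Matrix.one_mulVec, dotProduct_smul, smul_eq_mul, ← Complex.ofReal_pow,
    ← Complex.ofReal_pow, ← Complex.ofReal_mul, EuclideanSpace.real_norm_sq_eq]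
  simp only [dotProduct, pow_two]

/-- Up to normalization, `N(m, S)` has density `exp (-(x - m)ᵀ S⁻¹ (x - m) / 2)`. -/
theorem exists_multivariateGaussian_eq_smul_withDensity [DecidableEq ι] (m : EuclideanSpace ℝ ι)
    {S : Matrix ι ι ℝ} (hS : S.PosDef) :
    ∃ k : ℝ≥0∞, k ≠ 0 ∧ k ≠ ∞ ∧ multivariateGaussian m S =
      k • volume.withDensity fun x => ENNReal.ofReal
        (Real.exp (-((x - m).ofLp ⬝ᵥ S⁻¹ *ᵥ (x - m).ofLp) / 2)) := by
  have hR := hS.posSemidef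
  -- `N(m, S)` is by definition the image of the standard Gaussian under `T x = m + R x`, so its
  -- density follows from that of the standard Gaussian by changing variables along `T`.
  set R := CFC.sqrt S with hRdef
  have hRR : R * R = S := CFC.sqrt_mul_sqrt_self S hR.nonneg
  have hRt : Rᵀ = R := by
    simpa using (CFC.sqrt_nonneg S).posSemidef.isHermitian.eq
  have hdet : R.det ≠ 0 := fun h => hS.det_pos.ne' (by rw [← hRR, det_mul, h, zero_mul])
  have hunit : IsUnit R.det := isUnit_iff_ne_zero.mpr hdet
  set A := toEuclideanCLM (𝕜 := ℝ) R with hA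
  set T : EuclideanSpace ℝ ι → EuclideanSpace ℝ ι := fun x => m + A x with hT
  have hTm : Measurable T := by fun_prop
  have hdetA : LinearMap.det (A : EuclideanSpace ℝ ι →ₗ[ℝ] EuclideanSpace ℝ ι) ≠ 0 := by
    rwa [hA, coe_toEuclideanCLM_eq_toEuclideanLin, toEuclideanLin, toLpLin_eq_toLin, LinearMap.det_toLin]
  set q : EuclideanSpace ℝ ι → ℝ≥0∞ := fun x => ENNReal.ofReal
    (Real.exp (-((x - m).ofLp ⬝ᵥ S⁻¹ *ᵥ (x - m).ofLp) / 2)) with hq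
  have hqm : Measurable q := by
    refine ENNReal.measurable_ofReal.comp (Continuous.measurable ?_)
    fun_prop
  have hqT : ∀ x, q (T x) = ENNReal.ofReal (Real.exp (-‖x‖ ^ 2 / 2)) := by
    intro x
    have h1 : (T x - m).ofLp = R *ᵥ x.ofLp := by
      simp [hT, hA]
    -- Since `S⁻¹ = R⁻¹ R⁻¹` and `R` is symmetric, the quadratic form of `S⁻¹` pulls back to the
    -- squared norm.
    have h2 : R *ᵥ x.ofLp ⬝ᵥ S⁻¹ *ᵥ R *ᵥ x.ofLp = ‖x‖ ^ 2 := by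
      rw [← hRR, Matrix.mul_inv_rev, Matrix.mulVec_mulVec, Matrix.mul_assoc,
        Matrix.nonsing_inv_mul _ hunit, Matrix.mul_one, ← Matrix.vecMul_transpose, hRt,
        ← Matrix.dotProduct_mulVec, Matrix.mulVec_mulVec, Matrix.mul_nonsing_inv _ hunit,
        Matrix.one_mulVec, EuclideanSpace.real_norm_sq_eq]
      simp only [dotProduct, pow_two]
    simp only [hq, h1, h2]
  have hstd : stdGaussian (EuclideanSpace ℝ ι) =
      ENNReal.ofReal (Real.sqrt (2 * Real.pi) ^ Fintype.card ι)⁻¹ •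
        volume.withDensity (q ∘ T) := by
    have h := multivariateGaussian_isotropic one_pos (0 : EuclideanSpace ℝ ι)
    rw [one_pow, one_smul, multivariateGaussian_zero_one] at h
    rw [h, ← withDensity_smul _ (hqm.comp hTm)]
    congr 1
    ext x
    rw [Pi.smul_apply, Function.comp_apply, hqT, smul_eq_mul,
      ← ENNReal.ofReal_mul (by positivity)]
    simp [isotropicDensity]
  have hmap : (volume : Measure (EuclideanSpace ℝ ι)).map T =
      ENNReal.ofReal |(LinearMap.det (A : EuclideanSpace ℝ ι →ₗ[ℝ] EuclideanSpace ℝ ι))⁻¹| •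
        volume := by
    have hcomp : T = (fun x => m + x) ∘
        (A : EuclideanSpace ℝ ι →ₗ[ℝ] EuclideanSpace ℝ ι) := rfl
    rw [hcomp, ← Measure.map_map (measurable_const_add m) (by fun_prop),
      Measure.map_linearMap_addHaar_eq_smul_addHaar _ hdetA, Measure.map_smul, map_add_left_eq_self]
  refine ⟨ENNReal.ofReal (Real.sqrt (2 * Real.pi) ^ Fintype.card ι)⁻¹ * ENNReal.ofReal
    |(LinearMap.det (A : EuclideanSpace ℝ ι →ₗ[ℝ] EuclideanSpace ℝ ι))⁻¹|, mul_ne_zero ?_ ?_,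
    ENNReal.mul_ne_top ENNReal.ofReal_ne_top ENNReal.ofReal_ne_top, ?_⟩
  · rw [ne_eq, ENNReal.ofReal_eq_zero, not_le]
    positivity
  · rw [ne_eq, ENNReal.ofReal_eq_zero, not_le]
    exact abs_pos.mpr (inv_ne_zero hdetA)
  · change (stdGaussian (EuclideanSpace ℝ ι)).map T = _
    rw [hstd, Measure.map_smul, map_withDensity_comp _ hTm hqm, hmap, withDensity_smul_measure,
      smul_smul]

end Gaussian

end FedUnlearn

namespace FedUnlearn

/-! ### Bayes' formula for a dominated family -/

section Bayes

variable {Ω 𝓧 : Type*} [MeasurableSpace Ω] [MeasurableSpace 𝓧]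

/-- The normalized posterior density of a dominated model is a version of the conditional law. -/
theorem posterior_ae_eq_of_withDensity [StandardBorelSpace Ω] [Nonempty Ω] (μ : Measure Ω)
    [IsFiniteMeasure μ] (κ : Kernel Ω 𝓧) [IsFiniteKernel κ] (ν : Measure 𝓧) [SFinite ν]
    (l : Ω → 𝓧 → ℝ≥0∞) (hl : Measurable (Function.uncurry l))
    (hκ : ∀ ω, κ ω = ν.withDensity (l ω))
    (h0 : ∀ x, ∫⁻ ω, l ω x ∂μ ≠ 0) (htop : ∀ x, ∫⁻ ω, l ω x ∂μ ≠ ∞) :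
    ∀ᵐ x ∂(μ.bind κ), posterior κ μ x =
      (∫⁻ ω, l ω x ∂μ)⁻¹ • μ.withDensity fun ω => l ω x := by
  have hl' : Measurable (Function.uncurry fun x ω => l ω x) := hl.comp measurable_swap
  have hev : Measurable fun x => ∫⁻ ω, l ω x ∂μ := hl'.lintegral_prod_right
  -- Integrating an indicator over all of `Ω`, instead of over `s`, lets measurability in `x` follow
  -- from joint measurability.
  have hη_apply : ∀ x, ∀ s, MeasurableSet s →
      ((∫⁻ ω, l ω x ∂μ)⁻¹ • μ.withDensity fun ω => l ω x) s =
        (∫⁻ ω, l ω x ∂μ)⁻¹ * ∫⁻ ω, s.indicator (fun ω => l ω x) ω ∂μ := by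
    intro x s hs
    rw [Measure.smul_apply, withDensity_apply _ hs, smul_eq_mul, lintegral_indicator hs]
  let η : Kernel 𝓧 Ω :=
    { toFun := fun x => (∫⁻ ω, l ω x ∂μ)⁻¹ • μ.withDensity fun ω => l ω x
      measurable' := by
        refine Measure.measurable_of_measurable_coe _ fun s hs => ?_
        simp_rw [hη_apply _ s hs]
        refine hev.inv.mul (Measurable.lintegral_prod_right (f := fun x ω =>
          s.indicator (fun ω => l ω x) ω) ?_)
        exact hl'.indicator (measurable_snd hs) }
  have hη : IsMarkovKernel η := ⟨fun x => ⟨by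
    change ((∫⁻ ω, l ω x ∂μ)⁻¹ • μ.withDensity fun ω => l ω x) Set.univ = 1
    rw [hη_apply x _ MeasurableSet.univ, Set.indicator_univ,
      ENNReal.inv_mul_cancel (h0 x) (htop x)]⟩⟩
  have hbind : μ.bind κ = ν.withDensity fun x => ∫⁻ ω, l ω x ∂μ := by
    ext s hs
    rw [Measure.bind_apply hs κ.aemeasurable, withDensity_apply _ hs,
      lintegral_lintegral_swap hl'.aemeasurable]
    simp_rw [hκ, withDensity_apply _ hs]
  -- By uniqueness of disintegrations it suffices that the evidence law followed by `η` is the joint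
  -- law with its factors swapped. On a set `u` the evidence cancels, and both sides become iterated
  -- integrals of `l` over `u` in opposite orders.
  refine (ae_eq_posterior_of_compProd_eq (η := η) ?_).symm
  ext u hu
  rw [Measure.compProd_apply hu, Measure.map_apply measurable_swap hu,
    Measure.compProd_apply (measurable_swap hu), hbind,
    lintegral_withDensity_eq_lintegral_mul _ hev (Kernel.measurable_kernel_prodMk_left hu)]
  have h1 : ∀ x, ((fun x => ∫⁻ ω, l ω x ∂μ) * fun x => η x (Prod.mk x ⁻¹' u)) x =
      ∫⁻ ω, u.indicator (fun p => l p.2 p.1) (x, ω) ∂μ := by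
    intro x
    rw [Pi.mul_apply]
    change _ * ((∫⁻ ω, l ω x ∂μ)⁻¹ • μ.withDensity fun ω => l ω x) _ = _
    rw [hη_apply x _ (measurable_prodMk_left hu), ← mul_assoc,
      ENNReal.mul_inv_cancel (h0 x) (htop x), one_mul]
    rfl
  have h2 : ∀ ω, κ ω (Prod.mk ω ⁻¹' (Prod.swap ⁻¹' u)) =
      ∫⁻ x, u.indicator (fun p => l p.2 p.1) (x, ω) ∂ν := by
    intro ω
    rw [hκ, withDensity_apply _ (measurable_prodMk_left (measurable_swap hu)),
      ← lintegral_indicator (measurable_prodMk_left (measurable_swap hu))]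
    rfl
  simp_rw [h1, h2]
  exact lintegral_lintegral_swap (hl'.indicator hu).aemeasurable

end Bayes

/-! ### The posterior of the Bayesian linear model -/

section Posterior

variable {d c n : ℕ}

theorem likelihood_eq_prod (σ : ℝ) (f : Fin n → EuclideanSpace ℝ (Fin d))
    (y : Fin n → EuclideanSpace ℝ (Fin c)) (W : Matrix (Fin d) (Fin c) ℝ) :
    likelihood σ f y W = ∏ i, ENNReal.ofReal (isotropicDensity σ (labelMean W (f i)) (y i)) := by
  simp only [likelihood, isotropicDensity, Fintype.card_fin]

theorem measurable_likelihood (σ : ℝ) (f : Fin n → EuclideanSpace ℝ (Fin d)) :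
    Measurable (Function.uncurry fun (W : Matrix (Fin d) (Fin c) ℝ)
      (y : Fin n → EuclideanSpace ℝ (Fin c)) => likelihood σ f y W) := by
  change Measurable fun p : Matrix (Fin d) (Fin c) ℝ × (Fin n → EuclideanSpace ℝ (Fin c)) =>
    ∏ i, ENNReal.ofReal ((Real.sqrt (2 * Real.pi * σ ^ 2) ^ c)⁻¹ *
      Real.exp (-‖p.2 i - labelMean p.1 (f i)‖ ^ 2 / (2 * σ ^ 2)))
  refine Finset.measurable_prod _ fun i _ => ENNReal.measurable_ofReal.comp ?_
  have h : Measurable fun p : Matrix (Fin d) (Fin c) ℝ × (Fin n → EuclideanSpace ℝ (Fin c)) =>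
      p.2 i - labelMean p.1 (f i) :=
    ((measurable_pi_apply i).comp measurable_snd).sub
      ((measurable_labelMean (f i)).comp measurable_fst)
  exact ((((h.norm.pow_const 2).neg).div_const _).exp).const_mul _

/-- Lebesgue measure on label tuples serves as one reference measure for every `W`, so the model is
dominated. -/
theorem labelKernel_eq_withDensity {σ : ℝ} (hσ : 0 < σ)
    (f : Fin n → EuclideanSpace ℝ (Fin d)) (W : Matrix (Fin d) (Fin c) ℝ) :
    labelKernel c σ f W = volume.withDensity fun y => likelihood σ f y W := by
  change labelLaw σ f W = _
  have h := fun i => multivariateGaussian_isotropic hσ (labelMean W (f i))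
  -- `pi_withDensity` needs sigma-finite factors; these are Gaussian laws, hence probability
  -- measures.
  have : ∀ i, SigmaFinite ((volume : Measure (EuclideanSpace ℝ (Fin c))).withDensity
      fun x => ENNReal.ofReal (isotropicDensity σ (labelMean W (f i)) x)) := fun i => by
    rw [← h i]
    infer_instance
  simp_rw [labelLaw, h, likelihood_eq_prod]
  refine pi_withDensity volume _ fun i => ?_
  unfold isotropicDensity
  fun_prop

/-- Completing the square in the exponent of the joint density. -/
theorem completing_the_square {σ τ γ : ℝ} (hσ : 0 < σ) (hτ : 0 < τ) (hγ : γ = σ ^ 2 / τ ^ 2)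
    (F : Matrix (Fin n) (Fin d) ℝ) (Y : Matrix (Fin n) (Fin c) ℝ)
    (hA : (Fᵀ * F + γ • 1).PosDef) (W : Matrix (Fin d) (Fin c) ℝ) :
    (W.vec ⬝ᵥ W.vec) / τ ^ 2 + ((Y - F * W).vec ⬝ᵥ (Y - F * W).vec) / σ ^ 2 =
      (W - (Fᵀ * F + γ • 1)⁻¹ * (Fᵀ * Y)).vec ⬝ᵥ
        ((1 : Matrix (Fin c) (Fin c) ℝ) ⊗ₖ (σ ^ 2 • (Fᵀ * F + γ • 1)⁻¹))⁻¹ *ᵥ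
          (W - (Fᵀ * F + γ • 1)⁻¹ * (Fᵀ * Y)).vec +
      ((Y.vec ⬝ᵥ Y.vec) - ((Fᵀ * F + γ • 1)⁻¹ * (Fᵀ * Y)).vec ⬝ᵥ (Fᵀ * Y).vec) / σ ^ 2 := by
  set A := Fᵀ * F + γ • (1 : Matrix (Fin d) (Fin d) ℝ) with hAdef
  set M := A⁻¹ * (Fᵀ * Y) with hM
  have hunit : IsUnit A.det := isUnit_iff_ne_zero.mpr hA.det_pos.ne'
  have hAt : Aᵀ = A := by simpa using hA.isHermitian.eq
  have hAM : A * M = Fᵀ * Y := by rw [hM, Matrix.mul_nonsing_inv_cancel_left _ _ hunit]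
  have hMA : Mᵀ * A = Yᵀ * F := by
    rw [← hAt, ← Matrix.transpose_mul, hAM, Matrix.transpose_mul, Matrix.transpose_transpose]
  have hinv : ((1 : Matrix (Fin c) (Fin c) ℝ) ⊗ₖ (σ ^ 2 • A⁻¹))⁻¹ = 1 ⊗ₖ ((σ ^ 2)⁻¹ • A) := by
    refine Matrix.inv_eq_right_inv ?_
    rw [← Matrix.mul_kronecker_mul, Matrix.one_mul, Matrix.smul_mul, Matrix.mul_smul, smul_smul,
      mul_inv_cancel₀ (by positivity), one_smul, Matrix.nonsing_inv_mul _ hunit,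
      Matrix.one_kronecker_one]
  have hWG : (Wᵀ * (Fᵀ * Y)).trace = (Yᵀ * F * W).trace := by
    rw [← Matrix.trace_transpose]
    simp only [Matrix.transpose_mul, Matrix.transpose_transpose]
  have hFF : Fᵀ * F = A - γ • 1 := by rw [hAdef, add_sub_cancel_right]
  -- The Kronecker factor acts on `vec X` as left multiplication of `X`, so every quadratic form
  -- becomes a trace.
  rw [hinv, Matrix.kronecker_mulVec_vec, Matrix.transpose_one, Matrix.mul_one]
  simp only [Matrix.vec_dotProduct_vec]
  have e1 : ((Y - F * W)ᵀ * (Y - F * W)).trace = (Yᵀ * Y).trace - 2 * (Yᵀ * F * W).trace +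
      (Wᵀ * A * W).trace - γ * (Wᵀ * W).trace := by
    have : (Y - F * W)ᵀ * (Y - F * W) = Yᵀ * Y - Yᵀ * F * W - Wᵀ * (Fᵀ * Y) +
        Wᵀ * (Fᵀ * F) * W := by
      rw [Matrix.transpose_sub, Matrix.transpose_mul]
      simp only [Matrix.sub_mul, Matrix.mul_sub, Matrix.mul_assoc]
      abel
    rw [this, hFF, Matrix.mul_sub, Matrix.sub_mul, Matrix.mul_smul, Matrix.mul_one,
      Matrix.smul_mul]
    simp only [Matrix.trace_add, Matrix.trace_sub, Matrix.trace_smul, smul_eq_mul, hWG]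
    ring
  have e2 : ((W - M)ᵀ * ((σ ^ 2)⁻¹ • A * (W - M))).trace = (σ ^ 2)⁻¹ *
      ((Wᵀ * A * W).trace - 2 * (Yᵀ * F * W).trace + (Mᵀ * (Fᵀ * Y)).trace) := by
    have : (W - M)ᵀ * (A * (W - M)) = Wᵀ * A * W - Wᵀ * (A * M) - Mᵀ * A * W +
        Mᵀ * (A * M) := by
      rw [Matrix.transpose_sub]
      simp only [Matrix.sub_mul, Matrix.mul_sub, Matrix.mul_assoc]
      abel
    rw [Matrix.smul_mul, Matrix.mul_smul, Matrix.trace_smul, this, hAM, hMA, smul_eq_mul]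
    simp only [Matrix.trace_add, Matrix.trace_sub, hWG]
    ring
  -- Writing `Fᵀ F = A - γI` left `-γ tr(Wᵀ W) / σ²`; since `γ / σ² = 1 / τ²`, it cancels the prior
  -- term.
  rw [e1, e2, hγ]
  field_simp
  ring

theorem sum_sq_norm_sub_labelMean (f : Fin n → EuclideanSpace ℝ (Fin d))
    (y : Fin n → EuclideanSpace ℝ (Fin c)) (W : Matrix (Fin d) (Fin c) ℝ) :
    ∑ i, ‖y i - labelMean W (f i)‖ ^ 2 =
      ((Matrix.of fun i j => y i j) - (Matrix.of fun i j => f i j) * W).vec ⬝ᵥ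
        ((Matrix.of fun i j => y i j) - (Matrix.of fun i j => f i j) * W).vec := by
  simp only [dotProduct, Fintype.sum_prod_type, EuclideanSpace.real_norm_sq_eq]
  rw [Finset.sum_comm]
  refine Finset.sum_congr rfl fun j _ => Finset.sum_congr rfl fun i _ => ?_
  simp only [labelMean, Matrix.vec, Matrix.sub_apply, Matrix.of_apply, Matrix.mul_apply,
    PiLp.sub_apply, Matrix.mulVec, dotProduct, Matrix.transpose_apply, mul_comm (W _ _), pow_two]

theorem posDef_gram_add_smul_one {γ : ℝ} (hγ : 0 < γ) (F : Matrix (Fin n) (Fin d) ℝ) :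
    (Fᵀ * F + γ • 1).PosDef := by
  have h : (Fᵀ * F).PosSemidef := by
    simpa using Matrix.posSemidef_conjTranspose_mul_self F
  exact Matrix.PosDef.posSemidef_add h (Matrix.PosDef.one.smul hγ)

/-- Up to a constant factor, the joint density of parameter and labels is the unnormalized density
of the conjugate matrix normal law. -/
theorem exists_isotropicDensity_mul_likelihood_eq {σ τ γ : ℝ} (hσ : 0 < σ) (hτ : 0 < τ)
    (hγ : γ = σ ^ 2 / τ ^ 2) (f : Fin n → EuclideanSpace ℝ (Fin d))
    (y : Fin n → EuclideanSpace ℝ (Fin c)) (F : Matrix (Fin n) (Fin d) ℝ)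
    (hF : F = Matrix.of fun i j => f i j) (Y : Matrix (Fin n) (Fin c) ℝ)
    (hY : Y = Matrix.of fun i j => y i j) :
    ∃ C : ℝ, 0 < C ∧ ∀ v : EuclideanSpace ℝ (Fin c × Fin d),
      ENNReal.ofReal (isotropicDensity τ 0 v) * likelihood σ f y (unvec v) =
        ENNReal.ofReal C * ENNReal.ofReal (Real.exp
          (-((v - WithLp.toLp 2 ((Fᵀ * F + γ • 1)⁻¹ * (Fᵀ * Y)).vec).ofLp ⬝ᵥ
            ((1 : Matrix (Fin c) (Fin c) ℝ) ⊗ₖ (σ ^ 2 • (Fᵀ * F + γ • 1)⁻¹))⁻¹ *ᵥ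
              (v - WithLp.toLp 2 ((Fᵀ * F + γ • 1)⁻¹ * (Fᵀ * Y)).vec).ofLp) / 2)) := by
  have hγ0 : 0 < γ := by rw [hγ]; positivity
  have hA := posDef_gram_add_smul_one hγ0 F
  -- The constant collects the normalizations of the prior and of the `n` label densities, and the
  -- exponential of the remainder free of `W`.
  refine ⟨(Real.sqrt (2 * Real.pi * τ ^ 2) ^ Fintype.card (Fin c × Fin d))⁻¹ *
    ((Real.sqrt (2 * Real.pi * σ ^ 2) ^ c)⁻¹ ^ n * Real.exp (-(((Y.vec ⬝ᵥ Y.vec) -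
      ((Fᵀ * F + γ • 1)⁻¹ * (Fᵀ * Y)).vec ⬝ᵥ (Fᵀ * Y).vec) / σ ^ 2) / 2)), by positivity,
    fun v => ?_⟩
  have hsq := completing_the_square hσ hτ hγ F Y hA (unvec v)
  have hv : (v - WithLp.toLp 2 ((Fᵀ * F + γ • 1)⁻¹ * (Fᵀ * Y)).vec).ofLp =
      (unvec v - (Fᵀ * F + γ • 1)⁻¹ * (Fᵀ * Y)).vec := rfl
  have hnorm : ‖v‖ ^ 2 = (unvec v).vec ⬝ᵥ (unvec v).vec := by
    rw [EuclideanSpace.real_norm_sq_eq]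
    exact Finset.sum_congr rfl fun i _ => pow_two _
  have hsum := sum_sq_norm_sub_labelMean f y (unvec v)
  rw [← hF, ← hY] at hsum
  rw [hv, likelihood, ← ENNReal.ofReal_prod_of_nonneg fun i _ => by positivity,
    ← ENNReal.ofReal_mul (isotropicDensity_pos hτ _ _).le, ← ENNReal.ofReal_mul (by positivity)]
  congr 1
  rw [Finset.prod_mul_distrib, ← Real.exp_sum, Finset.prod_const, Finset.card_univ,
    Fintype.card_fin, ← Finset.sum_div, Finset.sum_neg_distrib, hsum, isotropicDensity, sub_zero,
    hnorm, mul_mul_mul_comm, ← Real.exp_add, ← mul_assoc, mul_assoc (_ * _), ← Real.exp_add]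
  congr 2
  linear_combination (-1 / 2) * hsq

/-- Prior times likelihood is a positive multiple of the conjugate matrix normal law. -/
theorem exists_prior_withDensity_likelihood_eq_smul {σ τ γ : ℝ} (hσ : 0 < σ) (hτ : 0 < τ)
    (hγ : γ = σ ^ 2 / τ ^ 2) (f : Fin n → EuclideanSpace ℝ (Fin d))
    (y : Fin n → EuclideanSpace ℝ (Fin c)) (F : Matrix (Fin n) (Fin d) ℝ)
    (hF : F = Matrix.of fun i j => f i j) (Y : Matrix (Fin n) (Fin c) ℝ)
    (hY : Y = Matrix.of fun i j => y i j) :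
    ∃ k : ℝ≥0∞, k ≠ 0 ∧ k ≠ ∞ ∧ (prior d c τ).withDensity (likelihood σ f y) =
      k • matrixNormal ((Fᵀ * F + γ • 1)⁻¹ * (Fᵀ * Y)) (σ ^ 2 • (Fᵀ * F + γ • 1)⁻¹) 1 := by
  have hγ0 : 0 < γ := by rw [hγ]; positivity
  have hA := posDef_gram_add_smul_one hγ0 F
  have hV : ((1 : Matrix (Fin c) (Fin c) ℝ) ⊗ₖ (σ ^ 2 • (Fᵀ * F + γ • 1)⁻¹)).PosDef :=
    Matrix.PosDef.one.kronecker (hA.inv.smul (pow_pos hσ 2))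
  obtain ⟨k, hk, hk', hN⟩ := exists_multivariateGaussian_eq_smul_withDensity
    (WithLp.toLp 2 ((Fᵀ * F + γ • 1)⁻¹ * (Fᵀ * Y)).vec) hV
  have hlm : Measurable (likelihood σ f y) :=
    (measurable_likelihood σ f).of_uncurry_right
  have hiso : Measurable fun v : EuclideanSpace ℝ (Fin c × Fin d) =>
      ENNReal.ofReal (isotropicDensity τ 0 v) := by
    unfold isotropicDensity
    fun_prop
  obtain ⟨C, hC0, hC⟩ := exists_isotropicDensity_mul_likelihood_eq hσ hτ hγ f y F hF Y hY
  refine ⟨ENNReal.ofReal C * k⁻¹,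
    mul_ne_zero (ENNReal.ofReal_pos.mpr hC0).ne' (ENNReal.inv_ne_zero.mpr hk'),
    ENNReal.mul_ne_top ENNReal.ofReal_ne_top (ENNReal.inv_ne_top.mpr hk), ?_⟩
  -- The reference measure is Lebesgue measure on the vectorized parameters.
  exact map_withDensity_eq_smul_map measurable_unvec hiso hlm ENNReal.ofReal_ne_top hk hk'
    (multivariateGaussian_isotropic hτ 0) hN hC

instance isProbabilityMeasure_matrixNormal (M : Matrix (Fin d) (Fin c) ℝ)
    (U : Matrix (Fin d) (Fin d) ℝ) (V : Matrix (Fin c) (Fin c) ℝ) :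
    IsProbabilityMeasure (matrixNormal M U V) :=
  Measure.isProbabilityMeasure_map measurable_unvec.aemeasurable

theorem bayesPosterior_eq_matrixNormal {σ τ γ : ℝ} (hσ : 0 < σ) (hτ : 0 < τ)
    (hγ : γ = σ ^ 2 / τ ^ 2) (f : Fin n → EuclideanSpace ℝ (Fin d))
    (y : Fin n → EuclideanSpace ℝ (Fin c)) (F : Matrix (Fin n) (Fin d) ℝ)
    (hF : F = Matrix.of fun i j => f i j) (Y : Matrix (Fin n) (Fin c) ℝ)
    (hY : Y = Matrix.of fun i j => y i j) :
    bayesPosterior σ τ f y =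
      matrixNormal ((Fᵀ * F + γ • 1)⁻¹ * (Fᵀ * Y)) (σ ^ 2 • (Fᵀ * F + γ • 1)⁻¹) 1 := by
  obtain ⟨k, hk, hk', h⟩ :=
    exists_prior_withDensity_likelihood_eq_smul hσ hτ hγ f y F hF Y hY
  exact inv_lintegral_smul_withDensity_eq hk hk' h

/-- By conjugacy the evidence equals the proportionality factor `k`, so it is nonzero and finite at
every `y`, as Bayes' formula requires. -/
theorem posterior_labelKernel_ae_eq {σ τ : ℝ} (hσ : 0 < σ) (hτ : 0 < τ)
    (f : Fin n → EuclideanSpace ℝ (Fin d)) :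
    ∀ᵐ y ∂(Measure.bind (prior d c τ) (labelKernel c σ f)),
      posterior (labelKernel c σ f) (prior d c τ) y = bayesPosterior σ τ f y := by
  have hev : ∀ y, ∫⁻ W, likelihood σ f y W ∂(prior d c τ) ≠ 0 ∧
      ∫⁻ W, likelihood σ f y W ∂(prior d c τ) ≠ ∞ := fun y => by
    obtain ⟨k, hk, hk', h⟩ :=
      exists_prior_withDensity_likelihood_eq_smul hσ hτ rfl f y _ rfl _ rfl
    have hmass := congrArg (fun m => m Set.univ) h
    simp only [withDensity_apply _ MeasurableSet.univ, Measure.restrict_univ, Measure.smul_apply,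
      measure_univ, smul_eq_mul, mul_one] at hmass
    rw [hmass]
    exact ⟨hk, hk'⟩
  exact posterior_ae_eq_of_withDensity (prior d c τ) (labelKernel c σ f) volume
    (fun W y => likelihood σ f y W) (measurable_likelihood σ f)
    (labelKernel_eq_withDensity hσ f) (fun y => (hev y).1) fun y => (hev y).2

end Posterior

end FedUnlearn

/-! ### Exactness of the federated protocol. -/

theorem theorem4 {X : Type*} (d c K : ℕ)
    -- the frozen feature extractor
    (φ : X → EuclideanSpace ℝ (Fin d))
    -- noise and prior standard deviations, and the ridge parameter
    (σ τ γ : ℝ) (hσ : 0 < σ) (hτ : 0 < τ) (hγ : γ = σ ^ 2 / τ ^ 2)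
    -- the batches that client `k` adds and deletes in round `t`, for `t ≥ 1`
    (add del : Fin K → ℕ → Multiset (FedUnlearn.Sample X c))
    -- only retained samples are deleted
    (hdel : ∀ k t, del k (t + 1) ≤ FedUnlearn.retained (add k) (del k) t)
    -- the server's ledger after each round, computed from the messages of the clients
    (L : ℕ → FedUnlearn.Ledger d c)
    (hL : L = FedUnlearn.ledger
      (fun t k => FedUnlearn.clientMessage φ (add k t) (del k t)))
    -- the global retained data at time `t`, listed in any order
    (t n : ℕ) (z : Fin n → FedUnlearn.Sample X c)
    (hz : Multiset.ofList (List.ofFn z) =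
      ∑ k, FedUnlearn.retained (add k) (del k) t) :
    -- the ledger holds the exact sufficient statistics of the retained data
    (L t).gram = (FedUnlearn.featureMatrix φ z)ᵀ * FedUnlearn.featureMatrix φ z ∧
    (L t).moment = (FedUnlearn.featureMatrix φ z)ᵀ * FedUnlearn.labelMatrix z ∧
    ((L t).gram + γ • 1).PosDef ∧
    -- Bayes' formula gives a version of the conditional law of `W` given the labels
    (∀ᵐ y ∂(Measure.bind (FedUnlearn.prior d c τ)
        (FedUnlearn.labelKernel c σ fun i => φ (z i).1)),
      posterior (FedUnlearn.labelKernel c σ fun i => φ (z i).1) (FedUnlearn.prior d c τ) y =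
        FedUnlearn.bayesPosterior σ τ (fun i => φ (z i).1) y) ∧
    -- the posterior given the retained data, in matrix-normal form
    FedUnlearn.bayesPosterior σ τ (fun i => φ (z i).1) (fun i => (z i).2) =
      FedUnlearn.matrixNormal (((L t).gram + γ • 1)⁻¹ * (L t).moment)
        (σ ^ 2 • ((L t).gram + γ • 1)⁻¹) 1 ∧
    -- the protocol maintains the posterior that is recomputed centrally from scratch
    FedUnlearn.protocolPosterior σ γ (L t) =
      FedUnlearn.bayesPosterior σ τ (fun i => φ (z i).1) (fun i => (z i).2) ∧
    InformationTheory.klDiv (FedUnlearn.protocolPosterior σ γ (L t))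
      (FedUnlearn.bayesPosterior σ τ (fun i => φ (z i).1) (fun i => (z i).2)) = 0 := by
  have hγ0 : 0 < γ := by rw [hγ]; positivity
  have hLt := FedUnlearn.ledger_eq φ add del hdel t z hz
  rw [← hL] at hLt
  have hgram := congrArg FedUnlearn.Ledger.gram hLt
  have hmoment := congrArg FedUnlearn.Ledger.moment hLt
  have hbayes : FedUnlearn.bayesPosterior σ τ (fun i => φ (z i).1) (fun i => (z i).2) =
      FedUnlearn.matrixNormal (((L t).gram + γ • 1)⁻¹ * (L t).moment)
        (σ ^ 2 • ((L t).gram + γ • 1)⁻¹) 1 := by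
    rw [hgram, hmoment]
    exact FedUnlearn.bayesPosterior_eq_matrixNormal hσ hτ hγ _ _ _ rfl _ rfl
  have hprotocol : FedUnlearn.protocolPosterior σ γ (L t) =
      FedUnlearn.bayesPosterior σ τ (fun i => φ (z i).1) (fun i => (z i).2) := by
    rw [hbayes]
    rfl
  refine ⟨hgram, hmoment, ?_, FedUnlearn.posterior_labelKernel_ae_eq hσ hτ _, hbayes, hprotocol,
    ?_⟩
  · rw [hgram]
    exact FedUnlearn.posDef_gram_add_smul_one hγ0 _
  -- Passing to the matrix normal form exposes a measure already known to be a probability measure,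
  -- which `klDiv_self` can use.
  · rw [hprotocol, hbayes]
    exact InformationTheory.klDiv_self _
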